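/- **Setting.** Consider an episodic MDP with horizon $H$, measurable state space $\mathcal S=\bigsqcup_{t=1}^H\mathcal S_t$ with $\mathcal S_1=\{s_1\}$, actions $[\mathcal A]=\{1,\dots,\mathcal A\}$ ($\mathcal A\ge 1$), transition kernel $P$ with $P(s,a)$ a distribution on $\mathcal S_{t+1}$ for $s\in\mathcal S_t$, $t<H$, and reward kernel $\mathcal R$ with $\mathcal R(s,a)$ a distribution on $[0,1]$. Let $\Pi$ be the set of memoryless (stochastic, measurable) policies, and $q^\pi(s,a)$ the expected total reward until the end of stage $H$ when starting in $s$ with action $a$ and following $\pi\in\Pi$ afterwards. Let $d\ge1$, $L_1,L_2>0$, let $\mathcal B(L)\subset\mathbb R^d$ be the closed Euclidean ball of radius $L$ centered at $0$, and let $\phi:\mathcal S\times[\mathcal A]\to\mathcal B(L_1)$ be a feature map. The uniform value-function approximation error is $$\eta=\sup_{\pi\in\Pi}\max_{h\in[H]}\inf_{\theta\in\mathcal B(L_2)}\sup_{(s,a)\in\mathcal S_h\times[\mathcal A]}\left|q^\pi(s,a)-\langle\phi(s,a),\theta\rangle\right| .$$ Fix any maps $\theta_h:\Pi\to\mathcal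 B(L_2)$, $h\in[H]$, with $|q^\pi(s,a)-\langle\phi(s,a),\theta_h(\pi)\rangle|\le\eta$ for all $\pi\in\Pi$ and $(s,a)\in\mathcal S_h\times[\mathcal A]$, and put, for $s\in\mathcal S_h$, $$\mathrm{range}(s)=\sup_{\pi\in\Pi}\max_{i,j\in[\mathcal A]}\langle\phi(s,i)-\phi(s,j),\theta_h(\pi)\rangle .$$ Call the MDP *$\kappa$-approximately linear with parameter norm bound $B$* if (i) there are $\theta_1,\dots,\theta_H\in\mathcal B(B)$ such that $|\mathbb E_{R\sim\mathcal R(s,a)}R-\langle\phi(s,a),\theta_h\rangle|\le\kappa$ for all $h\in[H]$ and $(s,a)\in\mathcal S_h\times[\mathcal A]$, and (ii) for every measurable $f:\mathcal S\to[0,H]$ and every $h\in[H-1]$ there is $\theta'_h\in\mathcal B(B)$ such that $|\mathbb E_{S'\sim P(s,a)}f(S')-\langle\phi(s,a),\theta'_h\rangle|\le\kappa$ for all $(s,a)\in\mathcal S_h\times[\mathcal A]$. Let $d_0=4d\log\log d+16$ (with $d_0=16$ when $d=1$). **Proposition 1.** There is a universal constant $C>0$ such that the following holds. If $\alpha>0$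 and there is no state $s\in\mathcal S$ with $\mathrm{range}(s)<\alpha$, then the MDP is $\kappa$-approximately linear with parameter norm bound $B$, where $$\kappa=\eta+\frac{5H\sqrt{2d}\,d_0\,\eta}{\alpha}\qquad\text{and}\qquad B\le\min\left\{L_2\left(\frac{4Hd_0\sqrt{2d}}{\alpha}+1\right),\ C\,\frac{L_2Hd_0\sqrt d}{\alpha}\right\}.$$ -/

import Mathlib

open MeasureTheory ProbabilityTheory
open scoped ENNReal

noncomputable section

/-- A finite-horizon Markov decision process with horizon `H`, actions `Fin A` and staged state
space `S`. The states of stage `h` (for `1 ≤ h ≤ H`) are `{s | stage s = h}`; stage `1` consists of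
the initial state alone. The transition kernel moves from each stage before the last one to the
next stage; its (arbitrary) values at states of the last stage are never used. Rewards lie
in `[0, 1]`. -/
structure MDP (S : Type*) [MeasurableSpace S] (A H : ℕ) where
  stage : S → ℕ
  measurable_stage : Measurable stage
  one_le_stage : ∀ s, 1 ≤ stage s
  stage_le : ∀ s, stage s ≤ H
  init : S
  stage_eq_one_iff : ∀ s, stage s = 1 ↔ s = init
  P : Kernel (S × Fin A) S
  markov_P : IsMarkovKernel P
  P_next : ∀ s a, stage s < H → P (s, a) {s' | stage s' = stage s + 1} = 1
  R : Kernel (S × Fin A) ℝ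
  markov_R : IsMarkovKernel R
  R_mem : ∀ s a, R (s, a) (Set.Icc 0 1) = 1

/-- Memoryless policies: measurable assignments of a distribution on actions to each state. -/
def Policy (S : Type*) [MeasurableSpace S] (A : ℕ) : Type _ :=
  {π : Kernel S (Fin A) // IsMarkovKernel π}

namespace MDP

variable {S : Type*} [MeasurableSpace S] {A H d : ℕ}

/-- One step of interaction under `π`: from `(s, a)`, the law of `(S', A')` where
`S' ∼ P(s, a)` and `A' ∼ π(S')`. -/
def next (M : MDP S A H) (π : Policy S A) : Kernel (S × Fin A) (S × Fin A) :=
  (Kernel.id ×ₖ π.1) ∘ₖ M.P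

/-- The law of the history `(S₀, A₀, R₀), …, (Sₙ, Aₙ, Rₙ)` when action `a` is used first in
state `s`, and policy `π` is followed afterwards. Given the current state and action, the reward
and the rest of the history are independent. -/
def history (M : MDP S A H) (π : Policy S A) :
    (n : ℕ) → Kernel (S × Fin A) (Fin (n + 1) → S × Fin A × ℝ)
  | 0 => (Kernel.id ×ₖ M.R).map (fun x _ => (x.1.1, x.1.2, x.2))
  | n + 1 => (Kernel.id ×ₖ (M.R ×ₖ (M.history π n ∘ₖ M.next π))).map
      (fun x => Fin.cons (x.1.1, x.1.2, x.2.1) x.2.2)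

/-- The action-value function `q^π(s, a)`: the expected total reward collected in stages
`stage s, …, H`. -/
def q (M : MDP S A H) (π : Policy S A) (s : S) (a : Fin A) : ℝ :=
  ∫ ω, ∑ i, (ω i).2.2 ∂(M.history π (H - M.stage s) (s, a))

/-- The expected reward of action `a` in state `s`. -/
def meanReward (M : MDP S A H) (s : S) (a : Fin A) : ℝ :=
  ∫ r, r ∂(M.R (s, a))

/-- The uniform value-function approximation error (misspecification) induced by the feature
map `φ` over parameters in the Euclidean ball of radius `L₂`. -/
def approxError (M : MDP S A H) (φ : S → Fin A → EuclideanSpace ℝ (Fin d)) (L₂ : ℝ) : ℝ≥0∞ :=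
  ⨆ π : Policy S A, ⨆ h ∈ Set.Icc 1 H,
    ⨅ ϑ ∈ Metric.closedBall (0 : EuclideanSpace ℝ (Fin d)) L₂,
      ⨆ s ∈ {s | M.stage s = h}, ⨆ a : Fin A, ENNReal.ofReal |M.q π s a - inner ℝ (φ s a) ϑ|

/-- `θ h π` is, for each stage `h` and memoryless policy `π`, a parameter in the ball of radius
`L₂` whose linear predictions are `η`-accurate for `q^π` on stage `h`. -/
def IsParam (M : MDP S A H) (φ : S → Fin A → EuclideanSpace ℝ (Fin d)) (L₂ η : ℝ)
    (θ : ℕ → Policy S A → EuclideanSpace ℝ (Fin d)) : Prop :=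
  ∀ h ∈ Set.Icc 1 H, ∀ π, θ h π ∈ Metric.closedBall 0 L₂ ∧
    ∀ s, M.stage s = h → ∀ a, |M.q π s a - inner ℝ (φ s a) (θ h π)| ≤ η

/-- The range of a state: the supremum over the parameters `Θ_h = {θ h π | π}` of its stage `h`
of the largest difference of predicted action-values between two actions. -/
def range (M : MDP S A H) (φ : S → Fin A → EuclideanSpace ℝ (Fin d))
    (θ : ℕ → Policy S A → EuclideanSpace ℝ (Fin d)) (s : S) : ℝ :=
  ⨆ ϑ : Set.range (θ (M.stage s)), ⨆ p : Fin A × Fin A,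
    inner ℝ (φ s p.1 - φ s p.2) (ϑ : EuclideanSpace ℝ (Fin d))

/-- `M` is a `κ`-approximately linear MDP with features `φ` and parameter norm bound `B`. -/
def IsApproxLinear (M : MDP S A H) (φ : S → Fin A → EuclideanSpace ℝ (Fin d)) (κ B : ℝ) : Prop :=
  (∃ θ : ℕ → EuclideanSpace ℝ (Fin d), ∀ h ∈ Set.Icc 1 H, θ h ∈ Metric.closedBall 0 B ∧
    ∀ s, M.stage s = h → ∀ a, |M.meanReward s a - inner ℝ (φ s a) (θ h)| ≤ κ) ∧
  ∀ f : S → ℝ, Measurable f → (∀ s, f s ∈ Set.Icc 0 (H : ℝ)) → ∀ h, 1 ≤ h → h < H →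
    ∃ θ' : EuclideanSpace ℝ (Fin d), θ' ∈ Metric.closedBall 0 B ∧
      ∀ s, M.stage s = h → ∀ a, |∫ s', f s' ∂(M.P (s, a)) - inner ℝ (φ s a) θ'| ≤ κ

end MDP

/-- `d₀ = 4 d log log d + 16`. At `d = 1`, where `log log d` is not defined, this is `16`, because
`Real.log 0 = 0`. -/
def designSize (d : ℕ) : ℝ := 4 * d * Real.log (Real.log d) + 16

end

/-!
Fix a stage `t < H`. If `π₁` and `π₂` agree after stage `t + 1`, then on stage `t` the difference of
their action values is the expectation over the next state of the difference of their state values,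
and it is linear in the features up to `2 η`. Taking `π₁` and `π₂` that follow `π` except on stage
`t + 1`, where `π₁` mixes the best and the worst action for `q^π` with weights `p` and `1 - p` and
`π₂` plays the worst one, shows that the expectation of `p ρ_π` is approximately linear, where
`ρ_π` is the gap between the best and the worst action (`MDP.exists_gap`). The gap is defined
through `q^π`, not through the predictions `⟨φ, θ⟩`, because `φ` need not be measurable.

It remains to write every `f : S → [0, H]` as a combination of such functions with small
coefficients. An approximate Auerbach basis (`exists_spanner`) of the bounded set of parameters of
stage `t + 1` gives `k ≤ d` policies `π_i` such that every parameter is a combination of theirs with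
coefficients in `[-2, 2]`. Hence `α ≤ range(s) ≤ 2 ∑ i, (ρ_i(s) + 2 η)`, and with `c = 2 H / α` the
function `g = ∑ i, c ρ_i` satisfies `f ≤ H ≤ g + 2 η k c`. So `f` is within `2 η k c` of
`min f g = ∑ i, c p ρ_i` with `p = min 1 (f / g)`. The total error is at most
`4 η k c ≤ 8 d H η / α` and the parameter norm at most `2 k c L₂ ≤ 4 d H L₂ / α`
(`MDP.exists_linear_expectation`). This is better than required, as
`2 d ≤ √d * designSize d` (`two_mul_sqrt_le_designSize`). Rewards are action values minus the
expectation of a state value with values in `[0, H]`, which adds `η` to the error and `L₂` to the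
norm (`MDP.exists_linear_meanReward`).

The second bound on `B` has no summand `L₂`; it absorbs this summand if `α ≤ 3 H`. Otherwise `η ≥ H`
(`MDP.horizon_le_approxError`), and the zero parameters suffice.
-/

/-! ### The size of the design -/

theorem two_mul_sqrt_le_designSize {d : ℕ} (hd : 0 < d) : 2 * √(d : ℝ) ≤ designSize d := by
  unfold designSize
  rcases le_or_gt d 2 with h2 | h2
  · have hs : √(d : ℝ) ≤ 2 := by
      rw [Real.sqrt_le_left (by norm_num)]
      have : (d : ℝ) ≤ 2 := by exact_mod_cast h2
      linarith
    interval_cases d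
    · norm_num at hs ⊢
    · have h := Real.log_two_gt_d9
      have h' : -1 ≤ Real.log (Real.log 2) := by
        have := Real.one_sub_inv_le_log_of_pos (x := Real.log 2) (by linarith)
        have h3 : (Real.log 2)⁻¹ ≤ 2 := by
          rw [inv_le_comm₀ (by linarith) (by norm_num)]; linarith
        linarith
      push_cast at hs ⊢
      linarith
  · have hd3 : (3 : ℝ) ≤ d := by exact_mod_cast h2
    have hs : √(d : ℝ) ≤ d := by
      rw [Real.sqrt_le_left (by linarith)]; nlinarith
    have he : Real.exp 1 ≤ d := by linarith [Real.exp_one_lt_d9]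
    have hlog : 1 ≤ Real.log d := by
      rwa [Real.le_log_iff_exp_le (by linarith)]
    have hll : 0 ≤ Real.log (Real.log d) := Real.log_nonneg hlog
    rcases le_or_gt d 64 with h64 | h64
    · have : √(d : ℝ) ≤ 8 := by
        rw [Real.sqrt_le_left (by norm_num)]
        have : (d : ℝ) ≤ 64 := by exact_mod_cast h64
        linarith
      have : 0 ≤ 4 * (d : ℝ) * Real.log (Real.log d) := by positivity
      linarith
    · -- `e² ≤ 64`, so `log log d ≥ log 2 ≥ 1 / 2`.
      have hlog2 : 2 ≤ Real.log d := by
        rw [Real.le_log_iff_exp_le (by linarith)]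
        have h1 : Real.exp 2 = Real.exp 1 * Real.exp 1 := by rw [← Real.exp_add]; norm_num
        have h64' : (64 : ℝ) ≤ d := by exact_mod_cast h64.le
        have := Real.exp_one_lt_d9
        have := Real.exp_pos 1
        nlinarith
      have hll2 : 1 / 2 ≤ Real.log (Real.log d) := by
        have := Real.log_le_log (by norm_num) hlog2
        linarith [Real.log_two_gt_d9]
      nlinarith

/-! ### Spanners of bounded sets -/

/-- Approximate Auerbach bases (barycentric spanners): a bounded set `Θ` contains at most
`finrank ℝ E` points such that every point of `Θ` is a combination of them with coefficients in
`[-2, 2]`. The constant `2` instead of `1` is the price for not assuming `Θ` compact. -/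
theorem exists_spanner {E : Type*} [NormedAddCommGroup E] [NormedSpace ℝ E]
    [FiniteDimensional ℝ E] {Θ : Set E} (hΘ : Bornology.IsBounded Θ) :
    ∃ k ≤ Module.finrank ℝ E, ∃ v : Fin k → E, (∀ i, v i ∈ Θ) ∧
      ∀ x ∈ Θ, ∃ c : Fin k → ℝ, (∀ i, |c i| ≤ 2) ∧ x = ∑ i, c i • v i := by
  let W := Submodule.span ℝ Θ
  let k := Module.finrank ℝ W
  let b : Module.Basis (Fin k) ℝ W := Module.finBasis ℝ W
  let T : Set (Fin k → W) := {v | ∀ i, (v i : E) ∈ Θ}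
  have hbdd : BddAbove ((fun v => |b.det v|) '' T) := by
    obtain ⟨L, hL⟩ := hΘ.subset_closedBall 0
    have hcont : Continuous fun v : Fin k → W => |b.det v| := by
      simp only [Module.Basis.det_apply]
      refine (Continuous.matrix_det (continuous_matrix fun i j => ?_)).abs
      exact (LinearMap.continuous_of_finiteDimensional (b.coord i)).comp (continuous_apply j)
    have : ProperSpace W := FiniteDimensional.proper ℝ W
    have hK : IsCompact (Set.univ.pi fun _ : Fin k => Metric.closedBall (0 : W) L) :=
      isCompact_univ_pi fun _ => isCompact_closedBall 0 L
    refine (hK.bddAbove_image hcont.continuousOn).mono (Set.image_mono (s := T) ?_)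
    intro v hv i _
    simpa using hL (hv i)
  obtain ⟨f, hfΘ, hfspan, hfli⟩ := Submodule.exists_fun_fin_finrank_span_eq ℝ Θ
  let f' : Fin k → W := fun i => ⟨f i, Submodule.subset_span (hfΘ i)⟩
  have hf' : LinearIndependent ℝ f' :=
    LinearIndependent.of_comp W.subtype (by simpa [f', Function.comp_def] using hfli)
  have hdet : b.det f' ≠ 0 := by
    have := (b.is_basis_iff_det (v := f')).1
      ⟨hf', hf'.span_eq_top_of_card_eq_finrank' (by simp [k])⟩
    exact this.ne_zero
  let m := sSup ((fun v => |b.det v|) '' T)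
  have hle : ∀ v ∈ T, |b.det v| ≤ m := fun v hv => le_csSup hbdd ⟨v, hv, rfl⟩
  have hm : 0 < m := (abs_pos.2 hdet).trans_le (hle f' hfΘ)
  obtain ⟨_, ⟨v, hvT, rfl⟩, hv⟩ := exists_lt_of_lt_csSup
    (s := (fun v => |b.det v|) '' T) ⟨_, f', hfΘ, rfl⟩ (half_lt_self hm)
  have hv0 : 0 < |b.det v| := (half_pos hm).trans hv
  obtain ⟨hli, hspan⟩ := (b.is_basis_iff_det (v := v)).2 (abs_pos.1 hv0).isUnit
  refine ⟨k, Submodule.finrank_le W, fun i => v i, hvT, fun x hx => ?_⟩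
  let x' : W := ⟨x, Submodule.subset_span hx⟩
  refine ⟨fun i => (Module.Basis.mk hli hspan.ge).repr x' i, fun i => ?_, ?_⟩
  · -- Cramer's rule
    have h := congrArg (fun l => l x') (b.det_smul_mk_coord_eq_det_update hli hspan.ge i)
    simp only [LinearMap.smul_apply, Module.Basis.coord_apply, smul_eq_mul] at h
    have hupd : |b.det (Function.update v i x')| ≤ m := by
      refine hle _ fun j => ?_
      rcases eq_or_ne j i with rfl | hj
      · simpa [x'] using hx
      · simpa [hj] using hvT j
    have h' := congrArg abs h
    rw [abs_mul] at h'
    have h2 : |b.det v| * |(Module.Basis.mk hli hspan.ge).repr x' i| ≤ m := h'.trans_le hupd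
    by_contra! hc
    nlinarith
  · have h := (Module.Basis.mk hli hspan.ge).sum_repr x'
    have h' := congrArg (W.subtype) h
    simpa [x'] using h'.symm

/-! ### Measurable maximizers -/

theorem exists_measurable_argmax {S : Type*} [MeasurableSpace S] {A : ℕ} (hA : 0 < A)
    {g : S → Fin A → ℝ} (hg : ∀ a, Measurable fun s => g s a) :
    ∃ m : S → Fin A, Measurable m ∧ ∀ s a, g s a ≤ g s (m s) := by
  classical
  have : Nonempty (Fin A) := ⟨⟨0, hA⟩⟩
  have hne : ∀ s, (Finset.univ.filter fun a => ∀ b, g s b ≤ g s a).Nonempty := fun s => by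
    obtain ⟨a, ha⟩ := Finite.exists_max (g s)
    exact ⟨a, by simpa using ha⟩
  have hmeas : ∀ a, MeasurableSet {s | ∀ b, g s b ≤ g s a} := fun a => by
    simp only [Set.ofPred_forall]
    exact MeasurableSet.iInter fun b => measurableSet_le (hg b) (hg a)
  -- The least maximizer is a measurable choice.
  refine ⟨fun s => (Finset.univ.filter fun a => ∀ b, g s b ≤ g s a).min' (hne s),
    measurable_to_countable' fun a => ?_, fun s a => ?_⟩
  · have : (fun s => (Finset.univ.filter fun a => ∀ b, g s b ≤ g s a).min' (hne s)) ⁻¹' {a} =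
        {s | ∀ b, g s b ≤ g s a} ∩ ⋂ c < a, {s | ∀ b, g s b ≤ g s c}ᶜ := by
      ext s
      simp only [Set.mem_preimage, Set.mem_singleton_iff, Finset.min'_eq_iff, Finset.mem_filter,
        Finset.mem_univ, true_and, Set.mem_inter_iff, Set.mem_ofPred_eq, Set.mem_iInter,
        Set.mem_compl_iff]
      refine and_congr_right fun _ => forall_congr' fun c => ?_
      rw [← not_lt]
      exact imp_not_comm
    rw [this]
    exact (hmeas a).inter (MeasurableSet.iInter fun c => MeasurableSet.iInter fun _ =>
      (hmeas c).compl)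
  · exact (Finset.mem_filter.1 (Finset.min'_mem _ (hne s))).2 a

namespace MDP

variable {S : Type*} [MeasurableSpace S] {A H d : ℕ}

/-! ### The law of the history -/

instance (π : Policy S A) : IsMarkovKernel π.1 := π.2

instance (M : MDP S A H) : IsMarkovKernel M.P := M.markov_P

instance (M : MDP S A H) : IsMarkovKernel M.R := M.markov_R

instance (M : MDP S A H) (π : Policy S A) : IsMarkovKernel (M.next π) := by
  unfold next; infer_instance

theorem measurable_history_cons (n : ℕ) :
    Measurable fun x : (S × Fin A) × ℝ × (Fin (n + 1) → S × Fin A × ℝ) =>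
      (Fin.cons (x.1.1, x.1.2, x.2.1) x.2.2 : Fin (n + 2) → S × Fin A × ℝ) := by
  refine measurable_pi_iff.2 fun i => ?_
  refine Fin.cases ?_ (fun j => ?_) i
  · simp only [Fin.cons_zero]; fun_prop
  · simp only [Fin.cons_succ]; fun_prop

instance (M : MDP S A H) (π : Policy S A) (n : ℕ) : IsMarkovKernel (M.history π n) := by
  induction n with
  | zero =>
    unfold history
    exact Kernel.IsMarkovKernel.map _ (by fun_prop)
  | succ n ih =>
    unfold history
    exact Kernel.IsMarkovKernel.map _ (measurable_history_cons n)

theorem history_zero_apply (M : MDP S A H) (π : Policy S A) (x : S × Fin A) :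
    M.history π 0 x = (M.R x).map fun r _ => (x.1, x.2, r) := by
  rw [history, Kernel.map_apply _ (by fun_prop), Kernel.prod_apply, Kernel.id_apply,
    Measure.dirac_prod, Measure.map_map (by fun_prop) (by fun_prop)]
  rfl

theorem history_succ_apply (M : MDP S A H) (π : Policy S A) (n : ℕ) (x : S × Fin A) :
    M.history π (n + 1) x = ((M.R x).prod ((M.history π n ∘ₖ M.next π) x)).map
      fun y => Fin.cons (x.1, x.2, y.1) y.2 := by
  rw [history, Kernel.map_apply _ (measurable_history_cons n), Kernel.prod_apply, Kernel.id_apply,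
    Measure.dirac_prod, Measure.map_map (measurable_history_cons n) (by fun_prop),
    Kernel.prod_apply]
  rfl

theorem measurable_history_cons_right (n : ℕ) (x : S × Fin A) :
    Measurable fun y : ℝ × (Fin (n + 1) → S × Fin A × ℝ) =>
      (Fin.cons (x.1, x.2, y.1) y.2 : Fin (n + 2) → S × Fin A × ℝ) :=
  (measurable_history_cons n).comp (measurable_const.prodMk measurable_id)

theorem measurableSet_rewards_mem (n : ℕ) :
    MeasurableSet {ω : Fin (n + 1) → S × Fin A × ℝ | ∀ i, (ω i).2.2 ∈ Set.Icc (0 : ℝ) 1} := by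
  simp only [Set.ofPred_forall]
  refine MeasurableSet.iInter fun i => ?_
  exact measurableSet_Icc.preimage (f := fun ω : Fin (n + 1) → S × Fin A × ℝ => (ω i).2.2)
    (by fun_prop)

theorem ae_reward_mem (M : MDP S A H) (x : S × Fin A) : ∀ᵐ r ∂M.R x, r ∈ Set.Icc (0 : ℝ) 1 :=
  mem_ae_iff_prob_eq_one measurableSet_Icc |>.2 (M.R_mem x.1 x.2)

theorem ae_history_rewards_mem (M : MDP S A H) (π : Policy S A) (n : ℕ) (x : S × Fin A) :
    ∀ᵐ ω ∂M.history π n x, ∀ i, (ω i).2.2 ∈ Set.Icc (0 : ℝ) 1 := by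
  induction n generalizing x with
  | zero =>
    rw [history_zero_apply, ae_map_iff (by fun_prop) (measurableSet_rewards_mem 0)]
    filter_upwards [M.ae_reward_mem x] with r hr i using hr
  | succ n ih =>
    rw [history_succ_apply, ae_map_iff (measurable_history_cons_right n x).aemeasurable
      (measurableSet_rewards_mem (n + 1))]
    have h1 : ∀ᵐ y ∂(M.R x).prod ((M.history π n ∘ₖ M.next π) x), y.1 ∈ Set.Icc (0 : ℝ) 1 :=
      Measure.quasiMeasurePreserving_fst.ae (M.ae_reward_mem x)
    have h2 : ∀ᵐ y ∂(M.R x).prod ((M.history π n ∘ₖ M.next π) x),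
        ∀ i, (y.2 i).2.2 ∈ Set.Icc (0 : ℝ) 1 :=
      Measure.quasiMeasurePreserving_snd.ae
        (Kernel.ae_comp_of_ae_ae (measurableSet_rewards_mem n) (.of_forall ih))
    filter_upwards [h1, h2] with y hy1 hy2 i
    refine Fin.cases ?_ (fun j => ?_) i
    · simpa using hy1
    · simpa using hy2 j

/-! ### Finite-step values and the Bellman equation -/

/-- The expected total reward of `n + 1` steps, starting with the state-action pair `x` and
following `π` afterwards. Unlike `MDP.q`, whose number of steps depends on the stage, it is
measurable in `x` and recursive in `n` by construction. -/
noncomputable def stepValue (M : MDP S A H) (π : Policy S A) (n : ℕ) (x : S × Fin A) : ℝ :=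
  ∫ ω, ∑ i, (ω i).2.2 ∂(M.history π n x)

/-- The expected total reward of `n + 1` steps from the state `s` under `π`. -/
noncomputable def stateValue (M : MDP S A H) (π : Policy S A) (n : ℕ) (s : S) : ℝ :=
  ∫ a, M.stepValue π n (s, a) ∂(π.1 s)

theorem q_eq_stepValue (M : MDP S A H) (π : Policy S A) {s : S} {n : ℕ} (h : M.stage s + n = H)
    (a : Fin A) : M.q π s a = M.stepValue π n (s, a) := by
  obtain rfl : n = H - M.stage s := by omega
  rfl

theorem measurable_totalReward (n : ℕ) :
    Measurable fun ω : Fin (n + 1) → S × Fin A × ℝ => ∑ i, (ω i).2.2 := by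
  fun_prop

theorem ae_history_totalReward_mem (M : MDP S A H) (π : Policy S A) (n : ℕ) (x : S × Fin A) :
    ∀ᵐ ω ∂M.history π n x, ∑ i, (ω i).2.2 ∈ Set.Icc (0 : ℝ) (n + 1) := by
  filter_upwards [M.ae_history_rewards_mem π n x] with ω hω
  refine ⟨Finset.sum_nonneg fun i _ => (hω i).1, ?_⟩
  calc ∑ i, (ω i).2.2 ≤ ∑ _i : Fin (n + 1), (1 : ℝ) := Finset.sum_le_sum fun i _ => (hω i).2
    _ = n + 1 := by simp

theorem integral_mem_Icc {Ω : Type*} [MeasurableSpace Ω] {μ : Measure Ω} [IsProbabilityMeasure μ]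
    {f : Ω → ℝ} {b : ℝ} (hf : AEStronglyMeasurable f μ) (h : ∀ᵐ x ∂μ, f x ∈ Set.Icc 0 b) :
    ∫ x, f x ∂μ ∈ Set.Icc 0 b := by
  refine ⟨integral_nonneg_of_ae (h.mono fun x hx => hx.1), ?_⟩
  calc ∫ x, f x ∂μ ≤ ∫ _, b ∂μ :=
        integral_mono_ae (Integrable.of_mem_Icc 0 b hf.aemeasurable h) (integrable_const b)
          (h.mono fun x hx => hx.2)
    _ = b := by simp

theorem measurable_stepValue (M : MDP S A H) (π : Policy S A) (n : ℕ) :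
    Measurable (M.stepValue π n) :=
  (StronglyMeasurable.integral_kernel (κ := M.history π n)
    (measurable_totalReward n).stronglyMeasurable).measurable

theorem measurable_stateValue (M : MDP S A H) (π : Policy S A) (n : ℕ) :
    Measurable (M.stateValue π n) :=
  (StronglyMeasurable.integral_kernel_prod_right' (κ := π.1)
    (M.measurable_stepValue π n).stronglyMeasurable).measurable

theorem stepValue_mem_Icc (M : MDP S A H) (π : Policy S A) (n : ℕ) (x : S × Fin A) :
    M.stepValue π n x ∈ Set.Icc (0 : ℝ) (n + 1) :=
  integral_mem_Icc (measurable_totalReward n).aestronglyMeasurable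
    (M.ae_history_totalReward_mem π n x)

theorem stateValue_mem_Icc (M : MDP S A H) (π : Policy S A) (n : ℕ) (s : S) :
    M.stateValue π n s ∈ Set.Icc (0 : ℝ) (n + 1) :=
  integral_mem_Icc ((M.measurable_stepValue π n).comp measurable_prodMk_left).aestronglyMeasurable
    (.of_forall fun a => M.stepValue_mem_Icc π n (s, a))

theorem meanReward_mem_Icc (M : MDP S A H) (s : S) (a : Fin A) :
    M.meanReward s a ∈ Set.Icc (0 : ℝ) 1 :=
  integral_mem_Icc measurable_id.aestronglyMeasurable (M.ae_reward_mem (s, a))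

theorem stepValue_zero (M : MDP S A H) (π : Policy S A) (x : S × Fin A) :
    M.stepValue π 0 x = M.meanReward x.1 x.2 := by
  rw [stepValue, history_zero_apply,
    integral_map (by fun_prop) (measurable_totalReward 0).aestronglyMeasurable]
  simp [meanReward]

theorem integral_next (M : MDP S A H) (π : Policy S A) (n : ℕ) (x : S × Fin A) :
    ∫ y, M.stepValue π n y ∂(M.next π x) = ∫ s, M.stateValue π n s ∂(M.P x) := by
  have hint : Integrable (M.stepValue π n) (M.next π x) :=
    Integrable.of_mem_Icc 0 (n + 1) (M.measurable_stepValue π n).aemeasurable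
      (.of_forall (M.stepValue_mem_Icc π n))
  unfold next at hint ⊢
  rw [Kernel.integral_comp hint]
  refine integral_congr_ae (.of_forall fun s => ?_)
  simp only [Kernel.prod_apply, Kernel.id_apply, Measure.dirac_prod]
  rw [integral_map (by fun_prop) (M.measurable_stepValue π n).aestronglyMeasurable]
  rfl

/-- The Bellman equation. -/
theorem stepValue_succ (M : MDP S A H) (π : Policy S A) (n : ℕ) (x : S × Fin A) :
    M.stepValue π (n + 1) x = M.meanReward x.1 x.2 + ∫ s, M.stateValue π n s ∂(M.P x) := by
  have hR : Integrable (fun r : ℝ => r) (M.R x) :=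
    Integrable.of_mem_Icc 0 1 aemeasurable_id (M.ae_reward_mem x)
  have hT : Integrable (fun ω : Fin (n + 1) → S × Fin A × ℝ => ∑ i, (ω i).2.2)
      ((M.history π n ∘ₖ M.next π) x) :=
    Integrable.of_mem_Icc 0 (n + 1) (measurable_totalReward n).aemeasurable
      (Kernel.ae_comp_of_ae_ae (measurableSet_Icc.preimage (measurable_totalReward n))
        (.of_forall (M.ae_history_totalReward_mem π n)))
  rw [stepValue, history_succ_apply, integral_map (measurable_history_cons_right n x).aemeasurable
    (measurable_totalReward (n + 1)).aestronglyMeasurable]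
  simp only [Fin.sum_univ_succ (n := n + 1), Fin.cons_zero, Fin.cons_succ]
  rw [integral_add (hR.comp_fst _) (hT.comp_snd _), integral_fun_fst (f := fun r : ℝ => r),
    integral_fun_snd (f := fun ω : Fin (n + 1) → S × Fin A × ℝ => ∑ i, (ω i).2.2),
    Kernel.integral_comp hT, ← integral_next]
  simp [meanReward, stepValue]

theorem ae_stage_eq (M : MDP S A H) {s : S} (hs : M.stage s < H) (a : Fin A) :
    ∀ᵐ s' ∂M.P (s, a), M.stage s' = M.stage s + 1 :=
  mem_ae_iff_prob_eq_one (M.measurable_stage (measurableSet_singleton (M.stage s + 1))) |>.2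
    (M.P_next s a hs)

/-- The value of a state-action pair depends on the policy only through later stages. -/
theorem stepValue_congr (M : MDP S A H) {π π' : Policy S A} {t : ℕ}
    (hπ : ∀ s, t < M.stage s → π.1 s = π'.1 s) (n : ℕ) (s : S) (hs : t ≤ M.stage s)
    (hn : M.stage s + n ≤ H) (a : Fin A) :
    M.stepValue π n (s, a) = M.stepValue π' n (s, a) := by
  induction n generalizing s a with
  | zero => rw [stepValue_zero, stepValue_zero]
  | succ n ih =>
    rw [stepValue_succ, stepValue_succ]
    congr 1
    refine integral_congr_ae ?_
    filter_upwards [M.ae_stage_eq (by omega) a] with s' hs'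
    rw [stateValue, stateValue, hπ s' (by omega)]
    exact integral_congr_ae (.of_forall fun a' => ih s' (by omega) (by omega) a')

/-! ### Modifying a policy on one stage -/

/-- A policy can be modified on a single stage `t` to play there the action `u s` with probability
`p s` and the action `l s` otherwise. -/
theorem exists_policy_mix (M : MDP S A H) (π : Policy S A) (t : ℕ) {p : S → ℝ} (hp : Measurable p)
    (hp01 : ∀ s, p s ∈ Set.Icc (0 : ℝ) 1) {u l : S → Fin A} (hu : Measurable u)
    (hl : Measurable l) :
    ∃ π' : Policy S A, (∀ s, M.stage s ≠ t → π'.1 s = π.1 s) ∧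
      ∀ s, M.stage s = t → ∀ g : Fin A → ℝ,
        ∫ a, g a ∂(π'.1 s) = p s * g (u s) + (1 - p s) * g (l s) := by
  classical
  let κ : Kernel S (Fin A) :=
    { toFun := fun s => ENNReal.ofReal (p s) • Measure.dirac (u s) +
        ENNReal.ofReal (1 - p s) • Measure.dirac (l s)
      measurable' := by
        refine Measure.measurable_of_measurable_coe _ fun B hB => ?_
        simp only [Measure.coe_add, Measure.coe_smul, Pi.add_apply, Pi.smul_apply, smul_eq_mul,
          Measure.dirac_apply' _ hB]
        have hB' : Measurable (B.indicator (1 : Fin A → ℝ≥0∞)) := measurable_one.indicator hB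
        exact (hp.ennreal_ofReal.mul (hB'.comp hu)).add
          ((measurable_const.sub hp).ennreal_ofReal.mul (hB'.comp hl)) }
  have hκ : ∀ s, κ s = ENNReal.ofReal (p s) • Measure.dirac (u s) +
      ENNReal.ofReal (1 - p s) • Measure.dirac (l s) := fun s => rfl
  have hκM : IsMarkovKernel κ := ⟨fun s => ⟨by
    have h0 := (hp01 s).1
    have h1 := (hp01 s).2
    rw [hκ]
    simp only [Measure.coe_add, Measure.coe_smul, Pi.add_apply, Pi.smul_apply, smul_eq_mul,
      measure_univ, mul_one]
    rw [← ENNReal.ofReal_add h0 (by linarith)]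
    simp⟩⟩
  have ht : MeasurableSet {s | M.stage s = t} := M.measurable_stage (measurableSet_singleton t)
  refine ⟨⟨Kernel.piecewise ht κ π.1, inferInstance⟩, fun s hs => ?_, fun s hs g => ?_⟩
  · simp only [Kernel.piecewise_apply]
    exact if_neg hs
  · have : Kernel.piecewise ht κ π.1 s = κ s := by
      rw [Kernel.piecewise_apply]
      exact if_pos hs
    have h0 := (hp01 s).1
    have h1 := (hp01 s).2
    simp only [this, hκ]
    rw [integral_add_measure (Integrable.of_finite.smul_measure ENNReal.ofReal_ne_top)
      (Integrable.of_finite.smul_measure ENNReal.ofReal_ne_top), integral_smul_measure,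
      integral_smul_measure, integral_dirac, integral_dirac, ENNReal.toReal_ofReal h0,
      ENNReal.toReal_ofReal (by linarith)]
    simp

/-- For every policy `π` and stage `t` before the last one there is a function `ρ` bounding all
gaps between action values of `π` on stage `t + 1` such that, for all measurable weights `p` in
`[0, 1]`, the expectation of `p ρ` after one step from stage `t` is a difference of two action-value
functions. Indeed, `ρ` is the gap between a best and a worst action, and one compares playing the
best action with probability `p` and the worst one otherwise to always playing the worst one. -/
theorem exists_gap (M : MDP S A H) (hA : 0 < A) (π : Policy S A) {t n : ℕ} (htn : t + 1 + n = H) :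
    ∃ ρ : S → ℝ, Measurable ρ ∧ (∀ s, ρ s ∈ Set.Icc (0 : ℝ) H) ∧
      (∀ s, M.stage s = t + 1 → ∀ a b, M.q π s a - M.q π s b ≤ ρ s) ∧
      ∀ p : S → ℝ, Measurable p → (∀ s, p s ∈ Set.Icc (0 : ℝ) 1) →
        ∃ π₁ π₂ : Policy S A, ∀ s, M.stage s = t → ∀ a,
          ∫ s', p s' * ρ s' ∂(M.P (s, a)) = M.q π₁ s a - M.q π₂ s a := by
  have hmeas : ∀ a, Measurable fun s => M.stepValue π n (s, a) := fun a =>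
    (M.measurable_stepValue π n).comp measurable_prodMk_right
  obtain ⟨u, hu, hu'⟩ := exists_measurable_argmax hA hmeas
  obtain ⟨l, hl, hl'⟩ := exists_measurable_argmax hA (g := fun s a => -M.stepValue π n (s, a))
    fun a => (hmeas a).neg
  have hnH : (n : ℝ) + 1 ≤ H := by exact_mod_cast (by omega : n + 1 ≤ H)
  refine ⟨fun s => M.stepValue π n (s, u s) - M.stepValue π n (s, l s),
    ((M.measurable_stepValue π n).comp (measurable_id.prodMk hu)).sub
      ((M.measurable_stepValue π n).comp (measurable_id.prodMk hl)), fun s => ?_,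
    fun s hs a b => ?_, fun p hp hp01 => ?_⟩
  · have h1 := (M.stepValue_mem_Icc π n (s, u s)).2
    have h2 := (M.stepValue_mem_Icc π n (s, l s)).1
    exact ⟨sub_nonneg.2 (hu' s (l s)), by linarith⟩
  · have h1 := hu' s a
    have h2 := hl' s b
    have hsn : M.stage s + n = H := by omega
    rw [M.q_eq_stepValue π hsn, M.q_eq_stepValue π hsn]
    linarith
  · obtain ⟨π₁, hπ₁, hmix₁⟩ := M.exists_policy_mix π (t + 1) hp hp01 hu hl
    obtain ⟨π₂, hπ₂, hmix₂⟩ := M.exists_policy_mix π (t + 1) (p := 0) measurable_const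
      (fun _ => ⟨le_rfl, zero_le_one⟩) hu hl
    refine ⟨π₁, π₂, fun s hs a => ?_⟩
    have hint : ∀ π', Integrable (M.stateValue π' n) (M.P (s, a)) := fun π' =>
      Integrable.of_mem_Icc 0 (n + 1) (M.measurable_stateValue π' n).aemeasurable
        (.of_forall (M.stateValue_mem_Icc π' n))
    rw [M.q_eq_stepValue π₁ (n := n + 1) (by omega), M.q_eq_stepValue π₂ (n := n + 1) (by omega),
      stepValue_succ, stepValue_succ, add_sub_add_left_eq_sub, ← integral_sub (hint _) (hint _)]
    refine integral_congr_ae ?_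
    filter_upwards [M.ae_stage_eq (by omega) a] with s' hs'
    have hval : ∀ π', (∀ s, M.stage s ≠ t + 1 → π'.1 s = π.1 s) →
        M.stateValue π' n s' = ∫ a, M.stepValue π n (s', a) ∂(π'.1 s') := fun π' hπ' =>
      integral_congr_ae (.of_forall fun a' => M.stepValue_congr (t := t + 1)
        (fun s hs => hπ' s hs.ne') n s' (by omega) (by omega) a')
    rw [hval π₁ hπ₁, hval π₂ hπ₂, hmix₁ s' (by omega), hmix₂ s' (by omega)]
    simp only [Pi.zero_apply]
    ring

theorem inner_sub_le_q_sub_add {M : MDP S A H} {φ : S → Fin A → EuclideanSpace ℝ (Fin d)}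
    {L₂ η : ℝ} {θ : ℕ → Policy S A → EuclideanSpace ℝ (Fin d)} (hθ : M.IsParam φ L₂ η θ)
    (π : Policy S A) (s : S) (a b : Fin A) :
    inner ℝ (φ s a - φ s b) (θ (M.stage s) π) ≤ M.q π s a - M.q π s b + 2 * η := by
  have h := (hθ (M.stage s) ⟨M.one_le_stage s, M.stage_le s⟩ π).2 s rfl
  have ha := abs_le.1 (h a)
  have hb := abs_le.1 (h b)
  rw [inner_sub_left]
  linarith [ha.1, hb.2]

theorem range_le {M : MDP S A H} {φ : S → Fin A → EuclideanSpace ℝ (Fin d)}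
    {θ : ℕ → Policy S A → EuclideanSpace ℝ (Fin d)} (hA : 0 < A) (π₀ : Policy S A) {s : S} {b : ℝ}
    (h : ∀ π a a', inner ℝ (φ s a - φ s a') (θ (M.stage s) π) ≤ b) : M.range φ θ s ≤ b := by
  have : Nonempty (Fin A) := ⟨⟨0, hA⟩⟩
  have : Nonempty (Set.range (θ (M.stage s))) := ⟨⟨_, π₀, rfl⟩⟩
  refine ciSup_le ?_
  rintro ⟨_, π, rfl⟩
  exact ciSup_le fun x => h π x.1 x.2

/-! ### Approximate linearity -/

/-- If all ranges are at least `α`, the spanner policies of stage `t + 1` together separate the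
actions in every state of that stage. -/
theorem exists_policies_le_sum_gap (M : MDP S A H) {φ : S → Fin A → EuclideanSpace ℝ (Fin d)}
    {L₂ η α : ℝ} {θ : ℕ → Policy S A → EuclideanSpace ℝ (Fin d)} (hA : 0 < A) (π₀ : Policy S A)
    (hθ : M.IsParam φ L₂ η θ) (hrange : ∀ s, α ≤ M.range φ θ s) {t : ℕ} (ht : t ∈ Set.Icc 1 H) :
    ∃ k ≤ d, ∃ π : Fin k → Policy S A, ∀ ρ : Fin k → S → ℝ,
      (∀ i s, M.stage s = t → ∀ a b, M.q (π i) s a - M.q (π i) s b ≤ ρ i s) →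
        ∀ s, M.stage s = t → α ≤ 2 * ∑ i, (ρ i s + 2 * η) := by
  have hbdd : Bornology.IsBounded (Set.range (θ t)) := by
    refine (Metric.isBounded_closedBall (x := 0) (r := L₂)).subset ?_
    rintro _ ⟨π, rfl⟩
    exact (hθ t ht π).1
  obtain ⟨k, hk, v, hv, hspan⟩ := exists_spanner hbdd
  choose π hπ using hv
  refine ⟨k, by simpa using hk, π, fun ρ hρ s hs => (hrange s).trans (range_le hA π₀ ?_)⟩
  intro π' a a'
  obtain ⟨c, hc, hsum⟩ := hspan (θ t π') ⟨π', rfl⟩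
  rw [hs, hsum, inner_sum, Finset.mul_sum]
  refine Finset.sum_le_sum fun i _ => ?_
  rw [inner_smul_right]
  have habs : |inner ℝ (φ s a - φ s a') (v i)| ≤ ρ i s + 2 * η := by
    have h := fun b b' => (inner_sub_le_q_sub_add hθ (π i) s b b').trans
      (add_le_add_left (hρ i s hs b b') _)
    rw [hs, hπ] at h
    refine abs_le'.2 ⟨h a a', ?_⟩
    rw [← inner_neg_left, neg_sub]
    exact h a' a
  calc c i * inner ℝ (φ s a - φ s a') (v i)
      ≤ |c i| * |inner ℝ (φ s a - φ s a') (v i)| := by rw [← abs_mul]; exact le_abs_self _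
    _ ≤ 2 * (ρ i s + 2 * η) := mul_le_mul (hc i) habs (abs_nonneg _) zero_le_two

/-- If all ranges are at least `α`, expectations over the next state of functions with values in
`[0, H]` are approximately linear in the features. -/
theorem exists_linear_expectation (M : MDP S A H) {φ : S → Fin A → EuclideanSpace ℝ (Fin d)}
    {L₂ η α : ℝ} {θ : ℕ → Policy S A → EuclideanSpace ℝ (Fin d)} (hA : 0 < A) (π₀ : Policy S A)
    (hL₂ : 0 < L₂) (hη : 0 ≤ η) (hα : 0 < α) (hθ : M.IsParam φ L₂ η θ)
    (hrange : ∀ s, α ≤ M.range φ θ s) {f : S → ℝ} (hf : Measurable f)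
    (hfH : ∀ s, f s ∈ Set.Icc 0 (H : ℝ)) {t : ℕ} (ht1 : 1 ≤ t) (htH : t < H) :
    ∃ θ' : EuclideanSpace ℝ (Fin d), ‖θ'‖ ≤ 4 * d * H * L₂ / α ∧
      ∀ s, M.stage s = t → ∀ a,
        |∫ s', f s' ∂(M.P (s, a)) - inner ℝ (φ s a) θ'| ≤ 8 * d * H * η / α := by
  obtain ⟨k, hkd, π, hπ⟩ := M.exists_policies_le_sum_gap hA π₀ hθ hrange (t := t + 1)
    ⟨by omega, htH⟩
  obtain ⟨n, hn⟩ := Nat.exists_eq_add_of_le (show t + 1 ≤ H from htH)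
  choose ρ hρ hρ0 hρq hρp using fun i => M.exists_gap hA (π i) hn.symm
  have hsum := hπ ρ hρq
  have hk : (k : ℝ) ≤ d := by exact_mod_cast hkd
  have hH : (0 : ℝ) < H := by exact_mod_cast (by omega : 0 < H)
  set c := 2 * (H : ℝ) / α with hc
  have hc0 : 0 < c := by positivity
  let g : S → ℝ := fun s => ∑ i, c * ρ i s
  have hg : Measurable g := Finset.measurable_fun_sum _ fun i _ => (hρ i).const_mul c
  have hg0 : ∀ s, 0 ≤ g s := fun s => Finset.sum_nonneg fun i _ => mul_nonneg hc0.le (hρ0 i s).1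
  -- The truncation of `f` at `g`, a sum of the gaps weighted by `p`.
  let p : S → ℝ := fun s => min 1 (f s / g s)
  have hp : Measurable p := measurable_const.min (hf.div hg)
  have hp01 : ∀ s, p s ∈ Set.Icc (0 : ℝ) 1 := fun s =>
    ⟨le_min zero_le_one (div_nonneg (hfH s).1 (hg0 s)), min_le_left _ _⟩
  have hpg : ∀ s, p s * g s = min (g s) (f s) := fun s => by
    rcases (hg0 s).eq_or_lt with h0 | h0
    · rw [← h0, mul_zero, min_eq_left (hfH s).1]
    · simp only [p]
      rw [min_mul_of_nonneg _ _ (hg0 s), one_mul, div_mul_cancel₀ _ h0.ne']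
  have hpgf : ∀ s, M.stage s = t + 1 → |f s - p s * g s| ≤ 2 * η * k * c := fun s hs => by
    have h1 : (H : ℝ) ≤ g s + 2 * η * k * c := by
      have h2 := mul_le_mul_of_nonneg_left (hsum s hs) (show 0 ≤ c / 2 by positivity)
      have h3 : c / 2 * α = H := by rw [hc]; field_simp
      rw [h3, Finset.sum_add_distrib] at h2
      simp only [g, ← Finset.mul_sum]
      simp only [Finset.sum_const, Finset.card_univ, Fintype.card_fin, nsmul_eq_mul] at h2
      linarith
    have h4 : 0 ≤ 2 * η * k * c := by positivity
    rw [hpg, abs_of_nonneg (sub_nonneg.2 (min_le_right _ _))]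
    rcases min_cases (g s) (f s) with h | h <;> linarith [(hfH s).2]
  choose π₁ π₂ hπ₁₂ using fun i => hρp i p hp hp01
  have htmem : t ∈ Set.Icc 1 H := ⟨ht1, htH.le⟩
  refine ⟨∑ i, c • (θ t (π₁ i) - θ t (π₂ i)), ?_, fun s hs a => ?_⟩
  · calc ‖∑ i, c • (θ t (π₁ i) - θ t (π₂ i))‖ ≤ ∑ _i : Fin k, c * (L₂ + L₂) := by
          refine norm_sum_le_of_le _ fun i _ => ?_
          rw [norm_smul, Real.norm_of_nonneg hc0.le]
          refine mul_le_mul_of_nonneg_left (norm_sub_le_of_le ?_ ?_) hc0.le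
          · simpa using (hθ t htmem (π₁ i)).1
          · simpa using (hθ t htmem (π₂ i)).1
      _ = k * (4 * H * L₂ / α) := by
          simp only [Finset.sum_const, Finset.card_univ, Fintype.card_fin, nsmul_eq_mul, hc]
          ring
      _ ≤ d * (4 * H * L₂ / α) := by gcongr
      _ = 4 * d * H * L₂ / α := by ring
  · have hintf : Integrable f (M.P (s, a)) :=
      Integrable.of_mem_Icc 0 H hf.aemeasurable (.of_forall hfH)
    have hintρ : ∀ i, Integrable (fun s' => p s' * ρ i s') (M.P (s, a)) := fun i =>
      Integrable.of_mem_Icc 0 H (hp.mul (hρ i)).aemeasurable (.of_forall fun s' =>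
        ⟨mul_nonneg (hp01 s').1 (hρ0 i s').1,
          (mul_le_of_le_one_left (hρ0 i s').1 (hp01 s').2).trans (hρ0 i s').2⟩)
    have hpgs : (fun s' => p s' * g s') = fun s' => ∑ i, c * (p s' * ρ i s') := by
      funext s'
      simp only [g, Finset.mul_sum]
      exact Finset.sum_congr rfl fun i _ => by ring
    have hintpg : Integrable (fun s' => p s' * g s') (M.P (s, a)) := by
      rw [hpgs]
      exact integrable_finsetSum _ fun i _ => (hintρ i).const_mul c
    have hE : ∫ s', p s' * g s' ∂(M.P (s, a)) =
        ∑ i, c * (M.q (π₁ i) s a - M.q (π₂ i) s a) := by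
      rw [hpgs, integral_finsetSum _ fun i _ => (hintρ i).const_mul c]
      exact Finset.sum_congr rfl fun i _ => by rw [integral_const_mul, hπ₁₂ i s hs a]
    have h1 : |∫ s', f s' ∂(M.P (s, a)) - ∫ s', p s' * g s' ∂(M.P (s, a))| ≤ 2 * η * k * c := by
      rw [← integral_sub hintf hintpg]
      have := norm_integral_le_of_norm_le_const (μ := M.P (s, a)) (C := 2 * η * k * c)
        (f := fun s' => f s' - p s' * g s') (by
          filter_upwards [M.ae_stage_eq (by omega) a] with s' hs'
          exact hpgf s' (by omega))
      simpa using this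
    have h2 : |∫ s', p s' * g s' ∂(M.P (s, a)) -
        inner ℝ (φ s a) (∑ i, c • (θ t (π₁ i) - θ t (π₂ i)))| ≤ k * (c * (2 * η)) := by
      rw [hE, inner_sum, ← Finset.sum_sub_distrib]
      calc |∑ i, (c * (M.q (π₁ i) s a - M.q (π₂ i) s a) -
              inner ℝ (φ s a) (c • (θ t (π₁ i) - θ t (π₂ i))))|
          ≤ ∑ _i : Fin k, c * (2 * η) := by
            rw [← Real.norm_eq_abs]
            refine norm_sum_le_of_le _ fun i _ => ?_
            rw [inner_smul_right, ← mul_sub, Real.norm_eq_abs, abs_mul, abs_of_pos hc0,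
              inner_sub_right]
            refine mul_le_mul_of_nonneg_left ?_ hc0.le
            have h1 := abs_le.1 ((hθ t htmem (π₁ i)).2 s hs a)
            have h2 := abs_le.1 ((hθ t htmem (π₂ i)).2 s hs a)
            exact abs_le.2 ⟨by linarith [h1.1, h2.2], by linarith [h1.2, h2.1]⟩
        _ = k * (c * (2 * η)) := by simp
    calc _ ≤ 2 * η * k * c + k * (c * (2 * η)) := (abs_sub_le _ _ _).trans (add_le_add h1 h2)
      _ = k * (8 * H * η / α) := by rw [hc]; ring
      _ ≤ d * (8 * H * η / α) := by gcongr
      _ = 8 * d * H * η / α := by ring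

/-- If all ranges are at least `α`, expected rewards are approximately linear in the features: they
are action values minus the expectation of a state value. -/
theorem exists_linear_meanReward (M : MDP S A H) {φ : S → Fin A → EuclideanSpace ℝ (Fin d)}
    {L₂ η α : ℝ} {θ : ℕ → Policy S A → EuclideanSpace ℝ (Fin d)} (hA : 0 < A) (π₀ : Policy S A)
    (hL₂ : 0 < L₂) (hη : 0 ≤ η) (hα : 0 < α) (hθ : M.IsParam φ L₂ η θ)
    (hrange : ∀ s, α ≤ M.range φ θ s) {t : ℕ} (ht : t ∈ Set.Icc 1 H) :
    ∃ θ' : EuclideanSpace ℝ (Fin d), ‖θ'‖ ≤ L₂ + 4 * d * H * L₂ / α ∧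
      ∀ s, M.stage s = t → ∀ a,
        |M.meanReward s a - inner ℝ (φ s a) θ'| ≤ η + 8 * d * H * η / α := by
  have hnorm : ‖θ t π₀‖ ≤ L₂ := by simpa using (hθ t ht π₀).1
  rcases ht.2.eq_or_lt with rfl | htH
  · refine ⟨θ t π₀, hnorm.trans (le_add_of_nonneg_right (by positivity)), fun s hs a => ?_⟩
    have h := (hθ t ht π₀).2 s hs a
    rw [M.q_eq_stepValue π₀ (n := 0) (by omega), stepValue_zero] at h
    exact h.trans (le_add_of_nonneg_right (by positivity))
  · obtain ⟨n, hn⟩ := Nat.exists_eq_add_of_le (show t + 1 ≤ H from htH)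
    have hnH : (n : ℝ) + 1 ≤ H := by exact_mod_cast (by omega : n + 1 ≤ H)
    obtain ⟨ϑ, hϑ, hE⟩ := M.exists_linear_expectation hA π₀ hL₂ hη hα hθ hrange
      (M.measurable_stateValue π₀ n) (fun s => ⟨(M.stateValue_mem_Icc π₀ n s).1,
        (M.stateValue_mem_Icc π₀ n s).2.trans hnH⟩) ht.1 htH
    refine ⟨θ t π₀ - ϑ, norm_sub_le_of_le hnorm hϑ, fun s hs a => ?_⟩
    have h := (hθ t ht π₀).2 s hs a
    rw [M.q_eq_stepValue π₀ (n := n + 1) (by omega), stepValue_succ] at h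
    have h' := hE s hs a
    rw [inner_sub_right]
    have h1 := abs_le.1 h
    have h2 := abs_le.1 h'
    exact abs_le.2 ⟨by linarith [h1.1, h2.2], by linarith [h1.2, h2.1]⟩

/-- If all ranges are at least `α > 3 H`, the features are useless: action values lie in `[0, H]`,
so gaps between predictions can only be this large if `η` is. -/
theorem horizon_le_approxError (M : MDP S A H) {φ : S → Fin A → EuclideanSpace ℝ (Fin d)}
    {L₂ η α : ℝ} {θ : ℕ → Policy S A → EuclideanSpace ℝ (Fin d)} (hA : 0 < A) (π₀ : Policy S A)
    (hθ : M.IsParam φ L₂ η θ) (hrange : ∀ s, α ≤ M.range φ θ s) (hα : 3 * H < α) : H ≤ η := by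
  have h : α ≤ H + 2 * η := by
    refine (hrange M.init).trans (range_le hA π₀ fun π a b => ?_)
    refine (inner_sub_le_q_sub_add hθ π M.init a b).trans (add_le_add_left ?_ _)
    have hs : M.stage M.init = 1 := (M.stage_eq_one_iff _).2 rfl
    have h1H : 1 ≤ H := hs ▸ M.stage_le M.init
    have hn : M.stage M.init + (H - 1) = H := by omega
    rw [M.q_eq_stepValue π hn, M.q_eq_stepValue π hn]
    have h1 := (M.stepValue_mem_Icc π (H - 1) (M.init, a)).2
    have h2 := (M.stepValue_mem_Icc π (H - 1) (M.init, b)).1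
    rw [Nat.cast_sub h1H] at h1
    push_cast at h1
    linarith
  linarith

theorem isApproxLinear_zero (M : MDP S A H) (φ : S → Fin A → EuclideanSpace ℝ (Fin d)) {κ : ℝ}
    (hκ : H ≤ κ) : M.IsApproxLinear φ κ 0 := by
  refine ⟨⟨0, fun t ht => ⟨by simp, fun s hs a => ?_⟩⟩, fun f hf hfH t ht htH =>
    ⟨0, by simp, fun s hs a => ?_⟩⟩
  · have h := M.meanReward_mem_Icc s a
    have h1 : (1 : ℝ) ≤ H := by exact_mod_cast ht.1.trans ht.2
    simp only [Pi.zero_apply, inner_zero_right, sub_zero]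
    rw [abs_of_nonneg h.1]
    linarith [h.2]
  · have h := integral_mem_Icc (μ := M.P (s, a)) hf.aestronglyMeasurable (.of_forall hfH)
    simp only [inner_zero_right, sub_zero]
    rw [abs_of_nonneg h.1]
    exact h.2.trans hκ

end MDP

theorem proposition1 :
    ∃ C : ℝ, 0 < C ∧
      ∀ (S : Type*) [MeasurableSpace S] (A H d : ℕ), 0 < A → 0 < d →
      ∀ (M : MDP S A H) (φ : S → Fin A → EuclideanSpace ℝ (Fin d)) (L₁ L₂ η α : ℝ),
        0 < L₁ → 0 < L₂ → 0 ≤ η → 0 < α →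
        (∀ s a, φ s a ∈ Metric.closedBall 0 L₁) →
        M.approxError φ L₂ = ENNReal.ofReal η →
        ∀ θ : ℕ → Policy S A → EuclideanSpace ℝ (Fin d), M.IsParam φ L₂ η θ →
          (¬ ∃ s, M.range φ θ s < α) →
          ∃ B : ℝ,
            B ≤ L₂ * (4 * H * designSize d * √(2 * d) / α + 1) ∧
            B ≤ C * (L₂ * H * designSize d * √d / α) ∧
            M.IsApproxLinear φ (η + 5 * H * √(2 * d) * designSize d * η / α) B := by
  refine ⟨4, by norm_num, fun S _ A H d hA hd M φ L₁ L₂ η α _ hL₂ hη hα _ _ θ hθ hr => ?_⟩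
  have hrange : ∀ s, α ≤ M.range φ θ s := fun s => not_lt.1 fun h => hr ⟨s, h⟩
  let π₀ : Policy S A := ⟨Kernel.const S (Measure.dirac ⟨0, hA⟩), inferInstance⟩
  have hd1 : (1 : ℝ) ≤ d := by exact_mod_cast hd
  -- The spanner needs only `d ≤ √d * designSize d / 2` policies.
  have hdD : 2 * (d : ℝ) ≤ √d * designSize d := by
    have h1 := mul_le_mul_of_nonneg_left (two_mul_sqrt_le_designSize hd) (Real.sqrt_nonneg (d : ℝ))
    have h2 := Real.mul_self_sqrt (Nat.cast_nonneg (α := ℝ) d)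
    linarith
  have hsqrt2 : 1 ≤ √(2 : ℝ) := Real.one_le_sqrt.2 one_le_two
  have hdD2 : 2 * (d : ℝ) ≤ designSize d * √(2 * d) := by
    rw [Real.sqrt_mul zero_le_two]
    nlinarith
  have hD : 0 ≤ designSize d := (by positivity : 0 ≤ 2 * √(d : ℝ)).trans
    (two_mul_sqrt_le_designSize hd)
  rcases lt_or_ge (3 * (H : ℝ)) α with hαH | hαH
  · refine ⟨0, by positivity, by positivity, M.isApproxLinear_zero φ ?_⟩
    exact (M.horizon_le_approxError hA π₀ hθ hrange hαH).trans
      (le_add_of_nonneg_right (by positivity))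
  · have hκ : 8 * d * H * η / α ≤ 5 * H * √(2 * d) * designSize d * η / α := by
      gcongr ?_ / α
      have : 0 ≤ (H : ℝ) * η := by positivity
      nlinarith
    refine ⟨L₂ + 4 * d * H * L₂ / α, ?_, ?_, ?_, ?_⟩
    · have : 4 * d * H * L₂ / α ≤ L₂ * (4 * H * designSize d * √(2 * d) / α) := by
        rw [← mul_div_assoc]
        gcongr ?_ / α
        have : 0 ≤ (H : ℝ) * L₂ := by positivity
        nlinarith
      linarith
    · -- Here `1 ≤ 3 H / α` absorbs the summand `L₂`.
      have h1 : L₂ + 4 * d * H * L₂ / α = (α * L₂ + 4 * d * H * L₂) / α := by field_simp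
      rw [h1, ← mul_div_assoc]
      gcongr ?_ / α
      have : 0 ≤ (H : ℝ) * L₂ := by positivity
      nlinarith
    · choose ϑ hϑ hϑr using fun t : Set.Icc 1 H =>
        M.exists_linear_meanReward hA π₀ hL₂ hη hα hθ hrange t.2
      refine ⟨fun t => if ht : t ∈ Set.Icc 1 H then ϑ ⟨t, ht⟩ else 0, fun t ht => ?_⟩
      simp only [dif_pos ht]
      exact ⟨by simpa using hϑ ⟨t, ht⟩, fun s hs a => (hϑr ⟨t, ht⟩ s hs a).trans (by linarith)⟩
    · intro f hf hfH t ht1 htH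
      obtain ⟨θ', hθ', hE⟩ :=
        M.exists_linear_expectation hA π₀ hL₂ hη hα hθ hrange hf hfH ht1 htH
      exact ⟨θ', by rw [mem_closedBall_zero_iff]; linarith,
        fun s hs a => (hE s hs a).trans (by linarith)⟩
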